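/- For each integer $k\ge 1$ define the integers $\mathrm{pod}_{-k}(n)$, $n\ge 0$, by the generating function \[\sum_{n=0}^{\infty}\mathrm{pod}_{-k}(n)q^{n}=\frac{(-q;q^{2})_{\infty}^{k}}{(q^{2};q^{2})_{\infty}^{k}},\qquad (a;x)_{\infty}=\prod_{i=0}^{\infty}(1-ax^{i}),\] as formal power series in $q$, and write $\mathrm{pod}(n)=\mathrm{pod}_{-1}(n)$. Then for every integer $n\ge 0$, \[\mathrm{pod}_{-3}(3n+2)\equiv 6\,\mathrm{pod}(9n+5)\pmod 9\] and \[\mathrm{pod}_{-3}(3n+1)\equiv 3\,\mathrm{pod}(9n+2)\pmod{18}.\] -/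

import Mathlib

open scoped PowerSeries PowerSeries.WithPiTopology

/-- The infinite `q`-shifted factorial `(a; q)_∞ = ∏_{i ≥ 0} (1 - a q ^ i)` as a formal power
series over `ℤ`, the product being taken coefficientwise. It converges whenever `q` has zero
constant term, see `multipliable_qPochInf`. -/
noncomputable def qPochInf (a q : ℤ⟦X⟧) : ℤ⟦X⟧ :=
  ∏' i : ℕ, (1 - a * q ^ i)

/-- The product defining `(a; q)_∞` converges if `q` has zero constant term. -/
theorem multipliable_qPochInf (a q : ℤ⟦X⟧) (hq : PowerSeries.constantCoeff q = 0) :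
    Multipliable fun i : ℕ => (1 - a * q ^ i : ℤ⟦X⟧) := by
  simp_rw [sub_eq_add_neg]
  apply PowerSeries.WithPiTopology.multipliable_one_add_of_tendsto_order_atTop_nhds_top
  rw [ENat.tendsto_nhds_top_iff_natCast_lt]
  intro n
  filter_upwards [Filter.eventually_gt_atTop n] with i hi
  rw [PowerSeries.order_neg]
  refine lt_of_lt_of_le (Nat.cast_lt.mpr hi) ?_
  refine PowerSeries.le_order _ _ fun j hj => ?_
  have hX : (PowerSeries.X : ℤ⟦X⟧) ^ i ∣ a * q ^ i :=
    Dvd.dvd.mul_left (pow_dvd_pow_of_dvd (PowerSeries.X_dvd_iff.mpr hq) i) a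
  exact PowerSeries.X_pow_dvd_iff.mp hX j (by exact_mod_cast hj)

/-- `(a; q)_∞` has constant term `1` if `a` and `q` have zero constant term. -/
theorem constantCoeff_qPochInf (a q : ℤ⟦X⟧) (ha : PowerSeries.constantCoeff a = 0)
    (hq : PowerSeries.constantCoeff q = 0) :
    PowerSeries.constantCoeff (qPochInf a q) = 1 := by
  rw [qPochInf, (multipliable_qPochInf a q hq).map_tprod _
    (PowerSeries.WithPiTopology.continuous_constantCoeff ℤ)]
  simp [ha]

/-- The generating function `(-q; q²)_∞ ^ k / (q²; q²)_∞ ^ k`, in the variable `q = X`. The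
denominator has constant term `1`, hence is invertible, see `podGenFun_mul`. -/
noncomputable def podGenFun (k : ℕ) : ℤ⟦X⟧ :=
  qPochInf (-PowerSeries.X) (PowerSeries.X ^ 2) ^ k *
    PowerSeries.invOfUnit (qPochInf (PowerSeries.X ^ 2) (PowerSeries.X ^ 2) ^ k) 1

/-- `podGenFun k` is indeed the quotient of the two products. -/
theorem podGenFun_mul (k : ℕ) :
    podGenFun k * qPochInf (PowerSeries.X ^ 2) (PowerSeries.X ^ 2) ^ k =
      qPochInf (-PowerSeries.X) (PowerSeries.X ^ 2) ^ k := by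
  rw [podGenFun, mul_assoc, mul_comm (PowerSeries.invOfUnit _ _),
    PowerSeries.mul_invOfUnit, mul_one]
  rw [map_pow, constantCoeff_qPochInf _ _ (by simp) (by simp)]
  simp

/-- `podNeg k n` is `pod_{-k}(n)`, the coefficient of `q ^ n` in
`(-q; q²)_∞ ^ k / (q²; q²)_∞ ^ k`. -/
noncomputable def podNeg (k n : ℕ) : ℤ :=
  PowerSeries.coeff n (podGenFun k)

/-- `pod(n) = pod_{-1}(n)`. -/
noncomputable def pod (n : ℕ) : ℤ :=
  podNeg 1 n

/-! ### A finite form of Gauss's identity. -/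

section ShanksIdentity

variable {R : Type*} [CommRing R]

/-! Gauss's identity makes the generating function of `pod` equal to 1/ψ(-q), so up to signs the
claim concerns J = 1/ψ and J³. Write A for `unsignedPentagonalSeries` and B = ψ(q³). The dissection
ψ(q) = A(q³) + qψ(q⁹) and the norm D = A³ + qB³, with inverse I, dissect J and J³ modulo 3
(`inverse_triangularSeries_dissection`, `inverse_triangularSeries_cube_dissection`). Modulo 9,
classes 1 and 2 of J³ are -3I²A²B and 6I²AB², while class 2 of J is IB².

Only the class of IB² modulo 3 matters after multiplication by 3 or 6. There Frobenius gives D = ψ,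
hence I = J, and dissecting J once more yields I²A²B and -I²AB² in the classes 9n+2 and 9n+5.

The modulus 18 also needs parity. Modulo 2, ψ = A³ and DB = ψ⁴, so IB² = J⁴B³. Its class 0 follows
from the fourth power being additive, and equals class 1 of J³. -/

theorem sum_shanks_telescope (q : R) (n m : ℕ) (hm : m ≤ n) :
    ∑ s ∈ Finset.range (m + 1),
      ((∏ k ∈ Finset.Ico s (n + 1), (1 - q ^ (2 * k + 2))) *
          (∏ k ∈ Finset.range s, (1 - q ^ (2 * k + 1))) * q ^ (s * (2 * n + 3)) -
        (1 - q ^ (2 * n + 1)) * ((∏ k ∈ Finset.Ico s n, (1 - q ^ (2 * k + 2))) *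
          (∏ k ∈ Finset.range s, (1 - q ^ (2 * k + 1))) * q ^ (s * (2 * n + 1)))) =
      (∏ k ∈ Finset.Ico m n, (1 - q ^ (2 * k + 2))) *
        (∏ k ∈ Finset.range (m + 1), (1 - q ^ (2 * k + 1))) * q ^ ((m + 1) * (2 * n + 1)) := by
  induction m with
  | zero =>
    rw [Finset.sum_range_one, Finset.prod_Ico_succ_top (Nat.zero_le n)]
    simp only [zero_add, Finset.prod_range_one, Finset.prod_range_zero]
    ring
  | succ m ih =>
    rw [Finset.sum_range_succ, ih (by omega), Finset.prod_Ico_succ_top hm,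
      Finset.prod_eq_prod_Ico_succ_bot (show m < n by omega),
      Finset.prod_range_succ _ (m + 1)]
    ring

/-- A finite form of Gauss's identity for triangular numbers, due to Shanks. -/
theorem prod_mul_sum_pow_triangle (q : R) (n : ℕ) :
    (∏ k ∈ Finset.range n, (1 - q ^ (2 * k + 1))) *
        ∑ s ∈ Finset.range (2 * n + 1), q ^ (s * (s + 1) / 2) =
      ∑ s ∈ Finset.range (n + 1), (∏ k ∈ Finset.Ico s n, (1 - q ^ (2 * k + 2))) *
        (∏ k ∈ Finset.range s, (1 - q ^ (2 * k + 1))) * q ^ (s * (2 * n + 1)) := by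
  induction n with
  | zero => simp
  | succ n ih =>
    -- The full telescoped sum leaves one boundary term. It and the new term s = n + 1 carry exactly
    -- the two new triangular exponents.
    have h := sum_shanks_telescope q n n le_rfl
    rw [Finset.sum_sub_distrib, ← Finset.mul_sum, ← ih] at h
    have e1 : (2 * n + 1) * (2 * n + 1 + 1) / 2 = (n + 1) * (2 * n + 1) := by
      rw [show (2 * n + 1) * (2 * n + 1 + 1) = 2 * ((n + 1) * (2 * n + 1)) by ring]
      omega
    have e2 : (2 * n + 1 + 1) * (2 * n + 1 + 1 + 1) / 2 = (n + 1) * (2 * n + 3) := by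
      rw [show (2 * n + 1 + 1) * (2 * n + 1 + 1 + 1) = 2 * ((n + 1) * (2 * n + 3)) by ring]
      omega
    rw [show 2 * (n + 1) + 1 = 2 * n + 1 + 1 + 1 by ring, Finset.sum_range_succ _ (2 * n + 1 + 1),
      Finset.sum_range_succ _ (2 * n + 1), e1, e2, Finset.sum_range_succ _ (n + 1),
      Finset.Ico_self, Finset.prod_empty, show 2 * n + 1 + 1 + 1 = 2 * n + 3 by ring,
      sub_eq_iff_eq_add.mp h, Finset.Ico_self, Finset.prod_empty, Finset.prod_range_succ _ n]
    ring

end ShanksIdentity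

/-! ### Gauss's identity and 1/ψ(-q) as generating function. -/

section TriangularSeries

open PowerSeries Filter

theorem isSquare_eight_mul_add_one_iff (n : ℕ) :
    IsSquare (8 * n + 1) ↔ ∃ s : ℕ, s * (s + 1) / 2 = n := by
  constructor
  · rintro ⟨r, hr⟩
    obtain ⟨s, rfl | rfl⟩ := Nat.even_or_odd' r
    · exfalso
      have : 2 * s * (2 * s) = 2 * (2 * s * s) := by ring
      omega
    · refine ⟨s, ?_⟩
      have : (2 * s + 1) * (2 * s + 1) = 4 * (s * (s + 1)) + 1 := by ring
      omega
  · rintro ⟨s, rfl⟩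
    refine ⟨2 * s + 1, ?_⟩
    have : (2 * s + 1) * (2 * s + 1) = 4 * (s * (s + 1)) + 1 := by ring
    have := (Nat.even_mul_succ_self s).two_dvd
    omega

theorem strictMono_triangle : StrictMono fun s : ℕ => s * (s + 1) / 2 := by
  refine strictMono_nat_of_lt_succ fun s => ?_
  have h : (s + 1) * (s + 1 + 1) = s * (s + 1) + 2 * (s + 1) := by ring
  simp only [h]
  omega

variable (R : Type*) [CommRing R]

/-- Ramanujan's theta function `ψ(q) = ∑ q ^ (s (s + 1) / 2)`. -/
noncomputable def triangularSeries : R⟦X⟧ :=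
  PowerSeries.mk fun n => if IsSquare (8 * n + 1) then 1 else 0

/-- The series `∑ q ^ (k (3 k - 1) / 2)` over all integers `k`. -/
noncomputable def unsignedPentagonalSeries : R⟦X⟧ :=
  PowerSeries.mk fun n => if IsSquare (24 * n + 1) then 1 else 0

variable {R}

theorem coeff_sum_pow_triangle (c : R) (N m : ℕ) (hN : m < N) :
    coeff m (∑ s ∈ Finset.range N, (C c * X : R⟦X⟧) ^ (s * (s + 1) / 2)) =
      coeff m (rescale c (triangularSeries R)) := by
  simp only [map_sum, mul_pow, ← map_pow, coeff_C_mul, coeff_X_pow, coeff_rescale,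
    triangularSeries, coeff_mk, mul_ite, mul_one, mul_zero]
  by_cases h : IsSquare (8 * m + 1)
  · rw [if_pos h]
    obtain ⟨t, rfl⟩ := (isSquare_eight_mul_add_one_iff m).mp h
    rw [Finset.sum_eq_single_of_mem t]
    · simp
    · exact Finset.mem_range.mpr ((strictMono_triangle.le_apply).trans_lt hN)
    · intro s _ hs
      exact if_neg fun h => hs (strictMono_triangle.injective h.symm)
  · rw [if_neg h]
    refine Finset.sum_eq_zero fun s _ => if_neg fun hs => h ?_
    exact (isSquare_eight_mul_add_one_iff m).mpr ⟨s, hs.symm⟩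

theorem multipliable_one_sub_C_mul_X_pow [TopologicalSpace R] (c : R) (f : ℕ → ℕ)
    (hf : ∀ i, i < f i) : Multipliable fun i => (1 : R⟦X⟧) - (C c * X) ^ f i := by
  simp_rw [sub_eq_add_neg]
  apply PowerSeries.WithPiTopology.multipliable_one_add_of_tendsto_order_atTop_nhds_top
  rw [ENat.tendsto_nhds_top_iff_natCast_lt]
  intro n
  filter_upwards [eventually_gt_atTop n] with i hi
  rw [order_neg]
  refine lt_of_lt_of_le (Nat.cast_lt.mpr (hi.trans (hf i))) ?_
  refine le_order _ _ fun j hj => ?_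
  rw [mul_pow, ← map_pow, coeff_C_mul, coeff_X_pow, if_neg, mul_zero]
  rintro rfl
  exact lt_irrefl _ hj

/-- **Gauss's identity** for triangular numbers. -/
theorem tprod_odd_mul_rescale_triangularSeries [TopologicalSpace R] [DiscreteTopology R] (c : R) :
    (∏' i : ℕ, ((1 : R⟦X⟧) - (C c * X) ^ (2 * i + 1))) * rescale c (triangularSeries R) =
      ∏' i : ℕ, ((1 : R⟦X⟧) - (C c * X) ^ (2 * i + 2)) := by
  have hO := (multipliable_one_sub_C_mul_X_pow c (fun i => 2 * i + 1)
    (by intro; omega)).hasProd.tendsto_prod_nat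
  have hE := (multipliable_one_sub_C_mul_X_pow c (fun i => 2 * i + 2)
    (by intro; omega)).hasProd.tendsto_prod_nat
  have hF : Tendsto (fun n => ∑ s ∈ Finset.range (2 * n + 1),
      (C c * X : R⟦X⟧) ^ (s * (s + 1) / 2)) atTop (nhds (rescale c (triangularSeries R))) := by
    rw [PowerSeries.WithPiTopology.tendsto_iff_coeff_tendsto]
    refine fun d => tendsto_atTop_of_eventually_const fun n (hn : d ≤ n) => ?_
    exact coeff_sum_pow_triangle c _ d (by omega)
  have hOF := (hO.mul hF).sub hE
  refine sub_eq_zero.mp (tendsto_nhds_unique hOF ?_)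
  rw [PowerSeries.WithPiTopology.tendsto_iff_coeff_tendsto]
  refine fun d => tendsto_atTop_of_eventually_const fun n (hn : d ≤ n) => ?_
  -- The term s = 0 is the even product. All others are divisible by X^(2n+1), so they do not reach
  -- degree d ≤ n.
  rw [prod_mul_sum_pow_triangle, Finset.sum_range_succ']
  simp only [Finset.range_zero, Finset.prod_empty, zero_mul, pow_zero, mul_one,
    ← Finset.range_eq_Ico, add_sub_cancel_right, map_zero]
  refine X_pow_dvd_iff.mp (Finset.dvd_sum fun s _ => Dvd.dvd.mul_left ?_ _) d
    (show d < 2 * n + 1 by omega)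
  rw [mul_pow]
  exact Dvd.dvd.mul_left (pow_dvd_pow _ (by nlinarith)) _

theorem podGenFun_one_mul_rescale_triangularSeries :
    podGenFun 1 * rescale (-1) (triangularSeries ℤ) = 1 := by
  have hP : qPochInf (-X) (X ^ 2) = ∏' i : ℕ, ((1 : ℤ⟦X⟧) - (C (-1) * X) ^ (2 * i + 1)) := by
    refine tprod_congr fun i => ?_
    simp only [map_neg, map_one, neg_one_mul, Odd.neg_pow ⟨i, rfl⟩]
    ring
  have hQ : qPochInf (X ^ 2) (X ^ 2) = ∏' i : ℕ, ((1 : ℤ⟦X⟧) - (C (-1) * X) ^ (2 * i + 2)) := by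
    refine tprod_congr fun i => ?_
    simp only [map_neg, map_one, neg_one_mul,
      Even.neg_pow (show Even (2 * i + 2) from ⟨i + 1, by ring⟩)]
    ring
  have h := podGenFun_mul 1
  rw [pow_one, pow_one, hQ, ← tprod_odd_mul_rescale_triangularSeries, ← hP] at h
  have hne : qPochInf (-X) (X ^ 2) ≠ 0 := by
    intro h0
    have := constantCoeff_qPochInf (-X) (X ^ 2) (by simp) (by simp)
    rw [h0] at this
    simp at this
  refine mul_right_cancel₀ hne ?_
  rw [one_mul]
  linear_combination h

theorem podGenFun_eq_pow (k : ℕ) : podGenFun k = podGenFun 1 ^ k := by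
  have hne : qPochInf (X ^ 2) (X ^ 2) ≠ 0 := by
    intro h0
    have := constantCoeff_qPochInf (X ^ 2) (X ^ 2) (by simp) (by simp)
    rw [h0] at this
    simp at this
  refine mul_right_cancel₀ (pow_ne_zero k hne) ?_
  rw [podGenFun_mul, ← mul_pow, ← pow_one (qPochInf (X ^ 2) (X ^ 2)), podGenFun_mul, pow_one]

end TriangularSeries

/-! ### The 3-dissections of ψ, 1/ψ and 1/ψ³. -/

section Dissection

open PowerSeries

variable {R : Type*} [CommRing R]

variable (R) in
/-- The substitution `X ↦ X ^ 3`. -/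
noncomputable abbrev substCube : R⟦X⟧ →ₐ[R] R⟦X⟧ := expand 3 three_ne_zero

theorem coeff_three_mul_dissection (F₀ F₁ F₂ : R⟦X⟧) (n : ℕ) :
    coeff (3 * n) (substCube R F₀ + X * substCube R F₁ + X ^ 2 * substCube R F₂) =
      coeff n F₀ := by
  simp only [map_add, coeff_expand_mul]
  rcases n with _ | n
  · simp
  · rw [show 3 * (n + 1) = 3 * n + 2 + 1 by ring, coeff_succ_X_mul, pow_two, mul_assoc,
      coeff_succ_X_mul, coeff_succ_X_mul, coeff_expand_of_not_dvd _ _ _ (by omega),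
      coeff_expand_of_not_dvd _ _ _ (by omega), add_zero, add_zero]

theorem coeff_three_mul_add_one_dissection (F₀ F₁ F₂ : R⟦X⟧) (n : ℕ) :
    coeff (3 * n + 1) (substCube R F₀ + X * substCube R F₁ + X ^ 2 * substCube R F₂) =
      coeff n F₁ := by
  simp only [map_add, coeff_succ_X_mul, coeff_expand_mul, pow_two, mul_assoc]
  rw [coeff_expand_of_not_dvd _ _ _ (by omega), zero_add, add_eq_left]
  rcases n with _ | n
  · simp
  · rw [show 3 * (n + 1) = 3 * n + 2 + 1 by ring, coeff_succ_X_mul,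
      coeff_expand_of_not_dvd _ _ _ (by omega)]

theorem coeff_three_mul_add_two_dissection (F₀ F₁ F₂ : R⟦X⟧) (n : ℕ) :
    coeff (3 * n + 2) (substCube R F₀ + X * substCube R F₁ + X ^ 2 * substCube R F₂) =
      coeff n F₂ := by
  rw [show 3 * n + 2 = 3 * n + 1 + 1 by ring]
  simp only [map_add, coeff_succ_X_mul, coeff_expand_mul, pow_two, mul_assoc]
  rw [coeff_expand_of_not_dvd _ _ _ (by omega), coeff_expand_of_not_dvd _ _ _ (by omega),
    zero_add, zero_add]

theorem isSquare_nine_mul_iff (m : ℕ) : IsSquare (9 * m) ↔ IsSquare m := by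
  constructor
  · rintro ⟨r, hr⟩
    obtain ⟨s, rfl⟩ : 3 ∣ r := by
      have : 3 ∣ r * r := ⟨3 * m, by omega⟩
      exact (Nat.prime_three.dvd_mul.mp this).elim id id
    exact ⟨s, by nlinarith⟩
  · rintro ⟨s, rfl⟩
    exact ⟨3 * s, by ring⟩

theorem mul_self_mod_nine (r : ℕ) :
    r * r % 9 = 0 ∨ r * r % 9 = 1 ∨ r * r % 9 = 4 ∨ r * r % 9 = 7 := by
  rw [Nat.mul_mod]
  have : r % 9 < 9 := Nat.mod_lt _ (by norm_num)
  interval_cases r % 9 <;> simp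

/-- The exponent d is triangular when 8d + 1 is a square. For d = 3n this is 24n + 1; for d = 3n + 1
divisibility by 9 forces n = 3m, leaving 9(8m + 1); for d = 3n + 2 squares modulo 9 exclude it. -/
theorem triangularSeries_dissection :
    triangularSeries R = substCube R (unsignedPentagonalSeries R) +
      X * substCube R (substCube R (triangularSeries R)) := by
  rw [← add_zero (substCube R _ + _), ← mul_zero (X ^ 2), ← map_zero (substCube R)]
  ext d
  obtain ⟨n, rfl | rfl | rfl⟩ : ∃ n, d = 3 * n ∨ d = 3 * n + 1 ∨ d = 3 * n + 2 :=
    ⟨d / 3, by omega⟩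
  · rw [coeff_three_mul_dissection]
    simp only [triangularSeries, unsignedPentagonalSeries, coeff_mk]
    congr! 2
    ring
  · rw [coeff_three_mul_add_one_dissection, coeff_expand]
    simp only [triangularSeries, coeff_mk]
    split_ifs with h₁ h₂ h₃ h₃ h₄ <;> try rfl
    · obtain ⟨m, rfl⟩ := h₂
      rw [Nat.mul_div_cancel_left _ (by norm_num), ← isSquare_nine_mul_iff] at h₃
      exact absurd (by convert h₁ using 1; ring) h₃
    · obtain ⟨r, hr⟩ := h₁
      have := mul_self_mod_nine r
      omega
    · obtain ⟨m, rfl⟩ := h₃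
      rw [Nat.mul_div_cancel_left _ (by norm_num), ← isSquare_nine_mul_iff] at h₄
      exact absurd (by convert h₄ using 1; ring) h₁
  · rw [coeff_three_mul_add_two_dissection, map_zero]
    simp only [triangularSeries, coeff_mk]
    refine if_neg ?_
    rintro ⟨r, hr⟩
    have := mul_self_mod_nine r
    omega

variable (R) in
/-- The norm of `ψ(q ^ (1 / 3))` over the series in `q`. -/
noncomputable def triangularNorm : R⟦X⟧ :=
  unsignedPentagonalSeries R ^ 3 + X * substCube R (triangularSeries R) ^ 3

/-- With a = A(q³) and b = ψ(q⁹), this is a³ + q³b³ = (a + qb)(a² - qab + q²b²). -/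
theorem inverse_triangularSeries_dissection {I J : R⟦X⟧} (hI : triangularNorm R * I = 1)
    (hJ : triangularSeries R * J = 1) :
    J = substCube R (I * unsignedPentagonalSeries R ^ 2) +
      X * substCube R (-(I * unsignedPentagonalSeries R * substCube R (triangularSeries R))) +
      X ^ 2 * substCube R (I * substCube R (triangularSeries R) ^ 2) := by
  have h := congrArg (substCube R) hI
  rw [triangularSeries_dissection] at hJ
  simp only [triangularNorm, map_mul, map_add, map_pow, map_neg, map_one, expand_X] at h ⊢
  generalize substCube R (substCube R (triangularSeries R)) = b at *
  generalize substCube R (unsignedPentagonalSeries R) = a at *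
  generalize substCube R I = i at *
  linear_combination (-J) * h + i * (a ^ 2 - X * a * b + X ^ 2 * b ^ 2) * hJ

/-- Cubing a² - qab + q²b² and eliminating a³ through the norm isolates the multiples of 9. Class 0
is never needed, hence the existential. -/
theorem inverse_triangularSeries_cube_dissection {I J : R⟦X⟧} (hI : triangularNorm R * I = 1)
    (hJ : triangularSeries R * J = 1) :
    ∃ F₀ : R⟦X⟧, J ^ 3 = substCube R F₀ +
      X * substCube R (-3 * I ^ 2 * unsignedPentagonalSeries R ^ 2 *
        substCube R (triangularSeries R) + 9 * (X * I ^ 3 * unsignedPentagonalSeries R ^ 2 *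
        substCube R (triangularSeries R) ^ 4)) +
      X ^ 2 * substCube R (6 * I ^ 2 * unsignedPentagonalSeries R *
        substCube R (triangularSeries R) ^ 2 - 9 * (X * I ^ 3 * unsignedPentagonalSeries R *
        substCube R (triangularSeries R) ^ 5)) := by
  have h := congrArg (substCube R) hI
  refine ⟨I ^ 3 * (unsignedPentagonalSeries R ^ 6 - 7 * X * (unsignedPentagonalSeries R *
    substCube R (triangularSeries R)) ^ 3 + X ^ 2 * substCube R (triangularSeries R) ^ 6), ?_⟩
  rw [inverse_triangularSeries_dissection hI hJ]
  simp only [triangularNorm, map_mul, map_add, map_sub, map_pow, map_neg, map_one, map_ofNat,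
    expand_X] at h ⊢
  generalize substCube R (substCube R (triangularSeries R)) = b at *
  generalize substCube R (unsignedPentagonalSeries R) = a at *
  generalize substCube R I = i at *
  linear_combination (-3 * X * a ^ 2 * b * i ^ 2 + 6 * X ^ 2 * a * b ^ 2 * i ^ 2) * h

theorem exists_triangularNorm_mul_eq_one : ∃ I, triangularNorm R * I = 1 := by
  refine isUnit_iff_exists_inv.mp (isUnit_iff_constantCoeff.mpr ?_)
  have : constantCoeff (unsignedPentagonalSeries R) = 1 := by
    rw [← coeff_zero_eq_constantCoeff_apply, unsignedPentagonalSeries, coeff_mk]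
    simp
  simp [triangularNorm, this]

end Dissection

/-! ### Frobenius modulo 3. -/

section ModThree

open PowerSeries

theorem pow_three_eq_substCube (f : (ZMod 3)⟦X⟧) : f ^ 3 = substCube (ZMod 3) f := by
  have h := MvPowerSeries.map_frobenius_expand (R := ZMod 3) (σ := Unit) 3 three_ne_zero (f := f)
  rw [ZMod.frobenius_zmod, MvPowerSeries.map_id] at h
  exact h.symm

theorem triangularNorm_zmod_three : triangularNorm (ZMod 3) = triangularSeries (ZMod 3) := by
  rw [triangularNorm, pow_three_eq_substCube, pow_three_eq_substCube]
  exact triangularSeries_dissection.symm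

/-- The class `2` part of `1 / ψ`, in terms of `ψ`, modulo `3`. -/
theorem inverse_class_two_zmod_three {J : (ZMod 3)⟦X⟧}
    (hJ : triangularSeries (ZMod 3) * J = 1) :
    J * substCube (ZMod 3) (triangularSeries (ZMod 3)) ^ 2 =
      substCube (ZMod 3) (J * triangularSeries (ZMod 3) ^ 2 *
          unsignedPentagonalSeries (ZMod 3) ^ 2) +
        X * substCube (ZMod 3) (-(J * triangularSeries (ZMod 3) ^ 2 *
          unsignedPentagonalSeries (ZMod 3) * substCube (ZMod 3) (triangularSeries (ZMod 3)))) +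
        X ^ 2 * substCube (ZMod 3) (J * triangularSeries (ZMod 3) ^ 2 *
          substCube (ZMod 3) (triangularSeries (ZMod 3)) ^ 2) := by
  have hI : triangularNorm (ZMod 3) * J = 1 := by rw [triangularNorm_zmod_three, hJ]
  conv_lhs => rw [inverse_triangularSeries_dissection hI hJ]
  simp only [map_mul, map_pow, map_neg]
  ring

theorem sq_mul_substCube_zmod_three {J : (ZMod 3)⟦X⟧}
    (hJ : triangularSeries (ZMod 3) * J = 1) :
    J ^ 2 * substCube (ZMod 3) (triangularSeries (ZMod 3)) =
      J * triangularSeries (ZMod 3) ^ 2 := by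
  rw [← pow_three_eq_substCube]
  linear_combination J * triangularSeries (ZMod 3) ^ 2 * hJ

end ModThree

/-! ### The parity relation. -/

section ModTwo

open PowerSeries

theorem two_eq_zero_zmod_two : (2 : (ZMod 2)⟦X⟧) = 0 := by
  rw [← map_ofNat (C (R := ZMod 2)), show (OfNat.ofNat 2 : ZMod 2) = 0 from rfl, map_zero]

instance charP_powerSeries_zmod_two : CharP (ZMod 2)⟦X⟧ 2 :=
  CharTwo.of_one_ne_zero_of_two_eq_zero one_ne_zero two_eq_zero_zmod_two

theorem mem_range_pentagonal_iff (n : ℕ) : n ∈ Set.range pentagonal ↔ IsSquare (24 * n + 1) := by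
  constructor
  · rintro ⟨k, rfl⟩
    refine ⟨(6 * k - 1).natAbs, ?_⟩
    have := two_mul_natCast_pentagonal k
    zify
    rw [abs_mul_abs_self]
    linear_combination 12 * this
  · rintro ⟨r, hr⟩
    have h6 : r % 6 = 1 ∨ r % 6 = 5 := by
      have h := congrArg (· % 6) hr
      simp only [Nat.mul_mod r r] at h
      have : r % 6 < 6 := Nat.mod_lt _ (by norm_num)
      interval_cases r % 6 <;> omega
    have key (k : ℤ) (hk : (r : ℤ) ^ 2 = (6 * k - 1) ^ 2) : pentagonal k = n := by
      have h₁ := two_mul_natCast_pentagonal k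
      zify at hr ⊢
      linarith
    rcases h6 with h | h
    · refine ⟨-((r / 6 : ℕ) : ℤ), key _ ?_⟩
      have : (r : ℤ) = 6 * (r / 6 : ℕ) + 1 := by omega
      generalize ((r / 6 : ℕ) : ℤ) = t at *
      rw [this]
      ring
    · refine ⟨((r / 6 : ℕ) : ℤ) + 1, key _ ?_⟩
      have : (r : ℤ) = 6 * (r / 6 : ℕ) + 5 := by omega
      generalize ((r / 6 : ℕ) : ℤ) = t at *
      rw [this]
      ring

theorem pentagonalSeries_zmod_two :
    pentagonalSeries (ZMod 2) = unsignedPentagonalSeries (ZMod 2) := by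
  ext n
  rw [unsignedPentagonalSeries, coeff_mk]
  split_ifs with h <;> rw [← mem_range_pentagonal_iff] at h
  · obtain ⟨k, rfl⟩ := h
    rw [coeff_pentagonalSeries_pentagonal]
    rcases Int.units_eq_one_or k.negOnePow with h | h <;> rw [h] <;> decide
  · exact coeff_pentagonalSeries_eq_zero _ h

/-- With E the product of all 1 - qⁱ, i ≥ 1, Gauss gives ψ = E(q²)²/E, which is E³ modulo 2, and
Euler's pentagonal theorem identifies E with A. -/
theorem triangularSeries_zmod_two :
    triangularSeries (ZMod 2) = unsignedPentagonalSeries (ZMod 2) ^ 3 := by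
  have hG := tprod_odd_mul_rescale_triangularSeries (1 : ZMod 2)
  have hE := WithPiTopology.tprod_one_sub_X_pow (ZMod 2)
  have hmul : (∏' i : ℕ, ((1 : (ZMod 2)⟦X⟧) - X ^ (2 * i + 1))) *
      ∏' i : ℕ, ((1 : (ZMod 2)⟦X⟧) - X ^ (2 * i + 2)) = ∏' i : ℕ, (1 - X ^ (i + 1)) := by
    have ho := multipliable_one_sub_C_mul_X_pow (1 : ZMod 2) (fun i => 2 * i + 1)
      (by intro; omega)
    have he := multipliable_one_sub_C_mul_X_pow (1 : ZMod 2) (fun i => 2 * i + 2)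
      (by intro; omega)
    simp only [map_one, one_mul] at ho he
    exact tprod_even_mul_odd (f := fun i => (1 : (ZMod 2)⟦X⟧) - X ^ (i + 1)) ho he
  have hsq : ∏' i : ℕ, ((1 : (ZMod 2)⟦X⟧) - X ^ (2 * i + 2)) =
      (∏' i : ℕ, (1 - X ^ (i + 1))) ^ 2 := by
    rw [← (WithPiTopology.multipliable_one_sub_X_pow (ZMod 2)).tprod_pow]
    refine tprod_congr fun i => ?_
    rw [sub_pow_char_of_commute _ (Commute.all _ _)]
    ring
  simp only [map_one, one_mul, rescale_one, RingHom.id_apply] at hG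
  rw [hsq] at hG hmul
  rw [hE] at hG hmul
  have hne : pentagonalSeries (ZMod 2) ≠ 0 := by
    rw [← hE]
    exact WithPiTopology.tprod_one_sub_X_pow_ne_zero (ZMod 2)
  rw [← pentagonalSeries_zmod_two]
  refine mul_right_cancel₀ hne ?_
  linear_combination -triangularSeries (ZMod 2) * hmul + pentagonalSeries (ZMod 2) ^ 2 * hG

theorem eq_zero_of_eq_X_mul_substCube {R : Type*} [CommRing R] {f : R⟦X⟧}
    (h : f = X * substCube R f) : f = 0 := by
  ext n
  induction n using Nat.strong_induction_on with
  | _ n ih =>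
    rw [h]
    rcases n with _ | n
    · simp
    · rw [coeff_succ_X_mul, coeff_expand]
      split_ifs
      · exact ih _ (by omega)
      · simp

/-- Since A³ = ψ, the claim is f = 0 for f = ψ⁴ + ψB + qB⁴. Cubing A(q³) = ψ - qψ(q⁹) gives B, from
which f = q f(q³). -/
theorem triangularNorm_mul_zmod_two :
    triangularNorm (ZMod 2) * substCube (ZMod 2) (triangularSeries (ZMod 2)) =
      triangularSeries (ZMod 2) ^ 4 := by
  have h2 : (2 : (ZMod 2)⟦X⟧) = 0 := two_eq_zero_zmod_two
  rw [triangularNorm, ← triangularSeries_zmod_two]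
  suffices h : triangularSeries (ZMod 2) ^ 4 +
      triangularSeries (ZMod 2) * substCube (ZMod 2) (triangularSeries (ZMod 2)) +
      X * substCube (ZMod 2) (triangularSeries (ZMod 2)) ^ 4 = 0 by
    linear_combination h - triangularSeries (ZMod 2) ^ 4 * h2
  apply eq_zero_of_eq_X_mul_substCube
  have hd := triangularSeries_dissection (R := ZMod 2)
  have hc := congrArg (substCube (ZMod 2)) triangularSeries_zmod_two
  simp only [map_add, map_mul, map_pow, expand_X] at hc ⊢
  generalize substCube (ZMod 2) (substCube (ZMod 2) (triangularSeries (ZMod 2))) = z at *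
  generalize substCube (ZMod 2) (triangularSeries (ZMod 2)) = y at *
  generalize triangularSeries (ZMod 2) = x at *
  rw [eq_sub_of_add_eq hd.symm] at hc
  linear_combination (x + X * z) * hc +
    (x ^ 4 - x ^ 3 * X * z + x * X ^ 3 * z ^ 3 - X ^ 4 * z ^ 4 - y * X * z) * h2

theorem inverse_pow_four_dissection_zmod_two {I J : (ZMod 2)⟦X⟧}
    (hI : triangularNorm (ZMod 2) * I = 1) (hJ : triangularSeries (ZMod 2) * J = 1) :
    I * substCube (ZMod 2) (triangularSeries (ZMod 2)) ^ 2 =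
      substCube (ZMod 2) (triangularSeries (ZMod 2) ^ 3 * I ^ 4 *
        unsignedPentagonalSeries (ZMod 2) ^ 8) +
      X * substCube (ZMod 2) (triangularSeries (ZMod 2) ^ 3 * X * (I *
        unsignedPentagonalSeries (ZMod 2) * substCube (ZMod 2) (triangularSeries (ZMod 2))) ^ 4) +
      X ^ 2 * substCube (ZMod 2) (triangularSeries (ZMod 2) ^ 3 * X ^ 2 * (I *
        substCube (ZMod 2) (triangularSeries (ZMod 2)) ^ 2) ^ 4) := by
  have hIJ : I = J ^ 4 * substCube (ZMod 2) (triangularSeries (ZMod 2)) := by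
    have h4 : (triangularSeries (ZMod 2) * J) ^ 4 = 1 := by rw [hJ, one_pow]
    linear_combination -I * h4 - I * J ^ 4 * triangularNorm_mul_zmod_two +
      J ^ 4 * substCube (ZMod 2) (triangularSeries (ZMod 2)) * hI
  have hfrob (a b c : (ZMod 2)⟦X⟧) : (a + b + c) ^ 4 = a ^ 4 + b ^ 4 + c ^ 4 := by
    rw [show 4 = 2 ^ 2 by norm_num, add_pow_char_pow, add_pow_char_pow]
  conv_lhs => rw [hIJ, inverse_triangularSeries_dissection hI hJ, hfrob]
  simp only [map_mul, map_pow, map_neg, expand_X]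
  ring

theorem class_one_eq_zmod_two {I : (ZMod 2)⟦X⟧} (hI : triangularNorm (ZMod 2) * I = 1) :
    triangularSeries (ZMod 2) ^ 3 * I ^ 4 * unsignedPentagonalSeries (ZMod 2) ^ 8 =
      I ^ 2 * unsignedPentagonalSeries (ZMod 2) ^ 2 *
        substCube (ZMod 2) (triangularSeries (ZMod 2)) +
      X * I ^ 3 * unsignedPentagonalSeries (ZMod 2) ^ 2 *
        substCube (ZMod 2) (triangularSeries (ZMod 2)) ^ 4 := by
  have hA := triangularSeries_zmod_two
  have hD := triangularNorm_mul_zmod_two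
  have hdef : triangularNorm (ZMod 2) = _ := rfl
  conv_rhs at hdef => rw [triangularNorm]
  have h2 : (2 : (ZMod 2)⟦X⟧) = 0 := two_eq_zero_zmod_two
  generalize substCube (ZMod 2) (triangularSeries (ZMod 2)) = b at *
  generalize unsignedPentagonalSeries (ZMod 2) = a at *
  generalize triangularSeries (ZMod 2) = x at *
  generalize triangularNorm (ZMod 2) = d at *
  have h₁ : x ^ 3 * I ^ 4 * a ^ 8 = I ^ 3 * a ^ 5 * b := by
    calc x ^ 3 * I ^ 4 * a ^ 8 = x ^ 3 * I ^ 4 * a ^ 5 * a ^ 3 := by ring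
      _ = I ^ 3 * a ^ 5 * b := by
        rw [← hA]
        linear_combination -I ^ 4 * a ^ 5 * hD + I ^ 3 * a ^ 5 * b * hI
  rw [h₁]
  linear_combination I ^ 2 * a ^ 2 * b * hI - I ^ 3 * a ^ 2 * b * hdef -
    I ^ 3 * a ^ 2 * b ^ 4 * X * h2

end ModTwo

/-! ### Reduction of the integral series and the final congruences. -/

section Congruences

open PowerSeries

variable {R : Type*} [CommRing R]

theorem map_triangularSeries :
    map (Int.castRingHom R) (triangularSeries ℤ) = triangularSeries R := by
  ext n
  simp only [coeff_map, triangularSeries, coeff_mk]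
  split_ifs <;> simp

theorem map_unsignedPentagonalSeries :
    map (Int.castRingHom R) (unsignedPentagonalSeries ℤ) = unsignedPentagonalSeries R := by
  ext n
  simp only [coeff_map, unsignedPentagonalSeries, coeff_mk]
  split_ifs <;> simp

theorem map_triangularNorm : map (Int.castRingHom R) (triangularNorm ℤ) = triangularNorm R := by
  simp only [triangularNorm, map_add, map_mul, map_pow, map_expand, map_X, map_triangularSeries,
    map_unsignedPentagonalSeries]

theorem coeff_modEq_of_map_eq {p : ℕ} {f g : ℤ⟦X⟧} {m n : ℕ}
    (h : coeff m (map (Int.castRingHom (ZMod p)) f) =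
      coeff n (map (Int.castRingHom (ZMod p)) g)) : coeff m f ≡ coeff n g [ZMOD p] := by
  rw [coeff_map, coeff_map] at h
  exact (ZMod.intCast_eq_intCast_iff _ _ p).mp h

theorem exists_series_of_inverse {J : ℤ⟦X⟧} (hJ : triangularSeries ℤ * J = 1) :
    ∃ G₁ G₂ : ℤ⟦X⟧,
      (∀ n, coeff (3 * n + 1) (J ^ 3) ≡ -3 * coeff n G₁ [ZMOD 9]) ∧
      (∀ n, coeff (3 * n + 2) (J ^ 3) ≡ 6 * coeff n G₂ [ZMOD 9]) ∧
      (∀ n, coeff (9 * n + 2) J ≡ coeff n G₁ [ZMOD 3]) ∧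
      (∀ n, coeff (9 * n + 5) J ≡ -coeff n G₂ [ZMOD 3]) ∧
      ∀ n, coeff (9 * n + 2) J ≡ coeff (3 * n + 1) (J ^ 3) [ZMOD 2] := by
  obtain ⟨I, hI⟩ := exists_triangularNorm_mul_eq_one (R := ℤ)
  obtain ⟨F₀, hcube⟩ := inverse_triangularSeries_cube_dissection hI hJ
  have hJ' (R : Type) [CommRing R] :
      triangularSeries R * map (Int.castRingHom R) J = 1 := by
    rw [← map_triangularSeries, ← map_mul, hJ, map_one]
  have hI' (R : Type) [CommRing R] :
      triangularNorm R * map (Int.castRingHom R) I = 1 := by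
    rw [← map_triangularNorm, ← map_mul, hI, map_one]
  have hIJ : map (Int.castRingHom (ZMod 3)) I = map (Int.castRingHom (ZMod 3)) J := by
    have h₁ := hI' (ZMod 3)
    rw [triangularNorm_zmod_three] at h₁
    exact (left_inv_eq_right_inv ((mul_comm _ _).trans (hJ' (ZMod 3))) h₁).symm
  have hone (n : ℕ) := congrArg (coeff (3 * n + 1)) hcube
  have htwo (n : ℕ) := congrArg (coeff (3 * n + 2)) hcube
  simp only [coeff_three_mul_add_one_dissection, coeff_three_mul_add_two_dissection] at hone htwo
  have hlow (n : ℕ) : coeff (3 * n + 2) J =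
      coeff n (I * substCube ℤ (triangularSeries ℤ) ^ 2) := by
    conv_lhs => rw [inverse_triangularSeries_dissection hI hJ, coeff_three_mul_add_two_dissection]
  have hC (a : ℤ) (n : ℕ) (f : ℤ⟦X⟧) : coeff n (C a * f) = a * coeff n f := coeff_C_mul n f a
  refine ⟨I ^ 2 * unsignedPentagonalSeries ℤ ^ 2 * substCube ℤ (triangularSeries ℤ),
    I ^ 2 * unsignedPentagonalSeries ℤ * substCube ℤ (triangularSeries ℤ) ^ 2,
    fun n => ?_, fun n => ?_, fun n => ?_, fun n => ?_, fun n => ?_⟩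
  · rw [hone, show (-3 : ℤ⟦X⟧) = C (-3) by simp, show (9 : ℤ⟦X⟧) = C 9 by simp, map_add,
      mul_assoc, mul_assoc, hC, hC, ← mul_assoc (I ^ 2)]
    exact Int.modEq_iff_dvd.mpr ⟨_, (sub_add_cancel_left _ _).trans (mul_neg _ _).symm⟩
  · rw [htwo, show (6 : ℤ⟦X⟧) = C 6 by simp, show (9 : ℤ⟦X⟧) = C 9 by simp, map_sub,
      mul_assoc, mul_assoc, hC, hC, ← mul_assoc (I ^ 2)]
    exact Int.modEq_iff_dvd.mpr ⟨_, sub_sub_cancel _ _⟩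
  · rw [show 9 * n + 2 = 3 * (3 * n) + 2 by ring, hlow]
    refine coeff_modEq_of_map_eq (p := 3) ?_
    simp only [map_mul, map_pow, map_expand, map_triangularSeries, map_unsignedPentagonalSeries,
      hIJ]
    rw [inverse_class_two_zmod_three (hJ' _), coeff_three_mul_dissection,
      ← sq_mul_substCube_zmod_three (hJ' _)]
    exact congrArg (coeff n) (by ring)
  · rw [show 9 * n + 5 = 3 * (3 * n + 1) + 2 by ring, hlow, ← map_neg]
    refine coeff_modEq_of_map_eq (p := 3) ?_
    simp only [map_mul, map_pow, map_neg, map_expand, map_triangularSeries,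
      map_unsignedPentagonalSeries, hIJ]
    rw [inverse_class_two_zmod_three (hJ' _), coeff_three_mul_add_one_dissection,
      ← sq_mul_substCube_zmod_three (hJ' _), map_neg]
    exact congrArg (fun f => -coeff n f) (by ring)
  · rw [show 9 * n + 2 = 3 * (3 * n) + 2 by ring, hlow, hone]
    refine coeff_modEq_of_map_eq (p := 2) ?_
    simp only [map_mul, map_pow, map_neg, map_add, map_expand, map_triangularSeries,
      map_unsignedPentagonalSeries, map_ofNat, map_X]
    rw [inverse_pow_four_dissection_zmod_two (hI' _) (hJ' _), coeff_three_mul_dissection,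
      class_one_eq_zmod_two (hI' _), ← map_add]
    refine congrArg (coeff n) ?_
    linear_combination (2 * (map (Int.castRingHom (ZMod 2)) I ^ 2 *
      unsignedPentagonalSeries (ZMod 2) ^ 2 * substCube (ZMod 2) (triangularSeries (ZMod 2))) -
      4 * (X * map (Int.castRingHom (ZMod 2)) I ^ 3 * unsignedPentagonalSeries (ZMod 2) ^ 2 *
        substCube (ZMod 2) (triangularSeries (ZMod 2)) ^ 4)) * two_eq_zero_zmod_two

end Congruences

theorem theorem3p3 (n : ℕ) :
    podNeg 3 (3 * n + 2) ≡ 6 * pod (9 * n + 5) [ZMOD 9] ∧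
      podNeg 3 (3 * n + 1) ≡ 3 * pod (9 * n + 2) [ZMOD 18] := by
  have hJ : triangularSeries ℤ * PowerSeries.rescale (-1) (podGenFun 1) = 1 := by
    have h := congrArg (PowerSeries.rescale (-1)) podGenFun_one_mul_rescale_triangularSeries
    rwa [map_mul, PowerSeries.rescale_rescale, neg_mul_neg, one_mul, PowerSeries.rescale_one,
      RingHom.id_apply, map_one, mul_comm] at h
  obtain ⟨G₁, G₂, h₁, h₂, h₃, h₄, h₅⟩ := exists_series_of_inverse hJ
  specialize h₁ n
  specialize h₂ n
  specialize h₃ n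
  specialize h₄ n
  specialize h₅ n
  simp only [← map_pow, ← podGenFun_eq_pow, PowerSeries.coeff_rescale] at h₁ h₂ h₃ h₄ h₅
  -- Signs from replacing q by -q; they turn the factors -3 and -1 of the series congruences into
  -- those of the theorem.
  have e₁ : (-1 : ℤ) ^ (3 * n + 1) = -(-1) ^ n := by rw [pow_succ, pow_mul]; norm_num
  have e₂ : (-1 : ℤ) ^ (3 * n + 2) = (-1) ^ n := by rw [pow_add, pow_mul]; norm_num
  have e₃ : (-1 : ℤ) ^ (9 * n + 2) = (-1) ^ n := by rw [pow_add, pow_mul]; norm_num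
  have e₄ : (-1 : ℤ) ^ (9 * n + 5) = -(-1) ^ n := by rw [pow_add, pow_mul]; norm_num
  rw [e₁] at h₁ h₅
  rw [e₂] at h₂
  rw [e₃] at h₃ h₅
  rw [e₄] at h₄
  simp only [pod, podNeg]
  simp only [Int.ModEq] at *
  -- The congruence modulo 18 combines `h₁` and `h₃` (modulo 9) with `h₅` (modulo 2).
  rcases neg_one_pow_eq_or ℤ n with h | h <;> rw [h] at h₁ h₂ h₃ h₄ h₅ <;> constructor <;> omega
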